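/- Let $\mathcal S,\mathcal A$ be finite sets, $C:\mathcal S\times\mathcal A\to[0,1]$ a cost, $P(\cdot\mid s,a)$ transition probabilities, $\gamma\in(0,1)$, $\lambda\in[0,1]$, $\alpha\in(0,1)$, and let $\mathcal H=\{h/H: h=0,\dots,H\}$ with $H\ge 1$, so $|\mathcal H|=H+1$. A policy is a pair $\pi=(\pi_1,\pi_2)\in\Delta(\mathcal A\times\mathcal H)^{|\mathcal S|+|\mathcal S||\mathcal H|}$ of conditional distributions $\pi_1(a,\eta\mid s)$ (first step) and $\pi_2(a,\eta'\mid s,\eta)$ (steps $t\ge2$). Put $$\bar c(s,\eta,a,\eta')=\tfrac{\lambda}{\alpha}\max\{C(s,a)-\eta,0\}+(1-\lambda)C(s,a)+\gamma\lambda\eta'.$$ Let $\Pr^\pi$ be the law of the trajectory in which $(a_1,\eta_2)\sim\pi_1(\cdot\mid s_1)$, $(a_t,\eta_{t+1})\sim\pi_2(\cdot\mid s_t,\eta_t)$ for $t\ge2$, and $s_{t+1}\sim P(\cdot\mid s_t,a_t)$ for $t\ge 1$, and for a distribution $\rho$ on $\mathcal S$ let $$J^\pi(\rho)=\mathbb E^{\pi}_{s_1\sim\rho}\Big[C(s_1,a_1)+\gamma\lambda\eta_2+\sum_{t\ge2}\gamma^{t-1}\bar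 c(s_t,\eta_t,a_t,\eta_{t+1})\Big],\qquad J^*(\rho)=\min_\pi J^\pi(\rho).$$ The same formula, a polynomial in $\pi_1$ and a power series in $\pi_2$, extends $J^\pi(\rho)$ to a neighbourhood of the set of policies in the Euclidean space of all coordinates of $\pi$, and $\nabla_\pi$ denotes the gradient in that space. Let $\rho^\pi(s,\eta)=\sum_{s_1,a_1}\rho(s_1)\pi_1(a_1,\eta\mid s_1)P(s\mid s_1,a_1)$ be the law of $(s_2,\eta_2)$, $$d^\pi_{\rho^\pi}(s,\eta)=(1-\gamma)\sum_{t\ge0}\gamma^t\,\Pr{}^{\pi}\big(s_{t+2}=s,\eta_{t+2}=\eta\mid (s_2,\eta_2)\sim\rho^\pi\big),\qquad \mu^P(s,\eta)=\sum_{s_1,a_1}\mu(s_1)P(s\mid s_1,a_1).$$ Write $$\|\bar c\|_\infty=\tfrac\lambda\alpha+(1-\lambda)+\gamma\lambda,\qquad \bar C=\tfrac\lambda\alpha+\lambda+\tfrac1{1-\gamma}\|\bar c\|_\infty,\qquad \beta=\frac{(1-\gamma)^3}{2\gamma|\mathcal A||\mathcal H|\,\|\bar c\|_\infty}.$$ Let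 $\mu$ be a distribution on $\mathcal S$, let $\pi^{(0)}$ be any policy, and let $\pi^{(t+1)}$ be the Euclidean projection of $\pi^{(t)}-\beta\nabla_\pi J^{\pi^{(t)}}(\mu)$ onto $\Delta(\mathcal A\times\mathcal H)^{|\mathcal S|+|\mathcal S||\mathcal H|}$ for $t\ge0$. Put $\pi_1^{LB}=\inf_{t\ge1}\min_{s,a,\eta}\pi_1^{(t)}(a,\eta\mid s)$. Then for every distribution $\rho$ on $\mathcal S$, every optimal policy $\pi^*$ (that is, $J^{\pi^*}(\rho)=J^*(\rho)$), every $\epsilon>0$ and every $T\in\mathbb N$, $$\min_{1\le t\le T}J^{\pi^{(t)}}(\rho)-J^*(\rho)\le\epsilon\quad\text{whenever}\quad T\ge D_1^2\,\frac{128\,\gamma|\mathcal S||\mathcal A||\mathcal H|^2}{(1-\gamma)^3\epsilon^2}\,\bar C\,\|\bar c\|_\infty,$$ where $$D_1=\max\Big\{\Big\|\frac{\rho}{\mu}\Big\|_\infty,\ \frac{1}{(1-\gamma)\pi_1^{LB}}\Big\|\frac{d^{\pi^*}_{\rho^{\pi^*}}}{\mu^P}\Big\|_\infty\Big\}\in[0,\infty],$$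 with the conventions $0/0=0$ and $c/0=\infty$ for $c>0$ (so there is no claim if $D_1=\infty$, in particular if $\pi_1^{LB}=0$). -/

import Mathlib

open scoped ENNReal

/-- A finite discounted Markov decision process with costs in `[0,1]`, together with the data of the
one-step risk measure `(1 - lam) * E + lam * CVaR_α` and of the grid `{h / H | h = 0, …, H}` in
which the auxiliary variable `η` takes its values. -/
structure RiskMDP (S A : Type*) [Fintype S] (H : ℕ) where
  /-- the cost `C(s,a)` -/
  C : S → A → ℝ
  C_nonneg : ∀ s a, 0 ≤ C s a
  C_le_one : ∀ s a, C s a ≤ 1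
  /-- the transition probabilities: `P s a s'` is `P(s' | s, a)` -/
  P : S → A → S → ℝ
  P_mem : ∀ s a, P s a ∈ stdSimplex ℝ S
  /-- the discount factor -/
  γ : ℝ
  γ_pos : 0 < γ
  γ_lt_one : γ < 1
  /-- the weight of the tail risk -/
  lam : ℝ
  lam_nonneg : 0 ≤ lam
  lam_le_one : lam ≤ 1
  /-- the confidence level of CVaR -/
  α : ℝ
  α_pos : 0 < α
  α_lt_one : α < 1
  H_pos : 0 < H

/-- The Euclidean space of parameters of the direct parameterization: a coordinate
`π₁(a, η | s)` for each `(s, a, η)` and a coordinate `π₂(a, η' | s, η)` for each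
`(s, η, a, η')`. The grid point `h / H` is represented by its index `h : Fin (H + 1)`. -/
abbrev PolicySpace (S A : Type*) (H : ℕ) : Type _ :=
  EuclideanSpace ℝ
    ((S × A × Fin (H + 1)) ⊕ (S × Fin (H + 1) × A × Fin (H + 1)))

/-- First-step policy: `first x s (a, h)` is `π₁(a, η | s)` with `η = h / H`. -/
def first {S A : Type*} {H : ℕ} (x : PolicySpace S A H) (s : S) (b : A × Fin (H + 1)) : ℝ :=
  x (Sum.inl (s, b.1, b.2))

/-- Stationary policy of the steps `t ≥ 2`: `later x (s, h) (a, h')` is `π₂(a, η' | s, η)`. -/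
def later {S A : Type*} {H : ℕ} (x : PolicySpace S A H) (p : S × Fin (H + 1))
    (b : A × Fin (H + 1)) : ℝ :=
  x (Sum.inr (p.1, p.2, b.1, b.2))

/-- The feasible set: the product of `|S| + |S||H|` probability simplices over `A × H`. -/
def policies (S A : Type*) [Fintype A] (H : ℕ) : Set (PolicySpace S A H) :=
  {x | (∀ s, first x s ∈ stdSimplex ℝ (A × Fin (H + 1))) ∧
    ∀ p, later x p ∈ stdSimplex ℝ (A × Fin (H + 1))}

/-- `y` is the Euclidean projection of `x` onto `K`. -/
def IsEuclideanProj {E : Type*} [NormedAddCommGroup E] (K : Set E) (x y : E) : Prop :=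
  y ∈ K ∧ ∀ z ∈ K, ‖x - y‖ ≤ ‖x - z‖

/-- The norm `‖f / g‖_∞` of the quotient of two nonnegative functions, with values in `[0, ∞]`:
it is `∞` if `g` vanishes somewhere where `f` does not. -/
noncomputable def supRatio {X : Type*} (f g : X → ℝ) : ℝ≥0∞ :=
  ⨆ i, ENNReal.ofReal (f i) / ENNReal.ofReal (g i)

namespace RiskMDP

variable {S A : Type*} [Fintype S] [Fintype A] {H : ℕ}

/-- The manipulated cost of the steps `t ≥ 2`,
`(lam / α) [C(s,a) - η]_+ + (1 - lam) C(s,a) + γ lam η'`. -/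
noncomputable def cbar (M : RiskMDP S A H) (p : S × Fin (H + 1)) (b : A × Fin (H + 1)) : ℝ :=
  M.lam / M.α * max (M.C p.1 b.1 - ((p.2 : ℕ) : ℝ) / H) 0 + (1 - M.lam) * M.C p.1 b.1
    + M.γ * M.lam * (((b.2 : ℕ) : ℝ) / H)

/-- The constant `‖c̄‖_∞ = lam / α + (1 - lam) + γ lam`. -/
noncomputable def cbarNorm (M : RiskMDP S A H) : ℝ :=
  M.lam / M.α + (1 - M.lam) + M.γ * M.lam

/-- The constant `C̄ = lam / α + lam + ‖c̄‖_∞ / (1 - γ)`. -/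
noncomputable def Cbar (M : RiskMDP S A H) : ℝ :=
  M.lam / M.α + M.lam + 1 / (1 - M.γ) * M.cbarNorm

/-- One-step transition matrix on the augmented states `(s, η)` under `π₂`:
`Pr(s_{t+1} = s', η_{t+1} = η' | s, η) = ∑ a, π₂(a, η' | s, η) P(s' | s, a)`.
Its `t`-th power holds the `t`-step transition probabilities. -/
noncomputable def trans (M : RiskMDP S A H) (x : PolicySpace S A H) :
    Matrix (S × Fin (H + 1)) (S × Fin (H + 1)) ℝ :=
  Matrix.of fun p q => ∑ a, later x p (a, q.2) * M.P p.1 a q.1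

/-- Distribution of `(s₂, η₂)` when `s₁ ∼ ν` and `π₁` is followed in the first step:
`ν^π(s, η) = ∑ s₁, ν(s₁) ∑ a₁, π₁(a₁, η | s₁) P(s | s₁, a₁)`. -/
noncomputable def secondDist (M : RiskMDP S A H) (x : PolicySpace S A H) (ν : S → ℝ)
    (q : S × Fin (H + 1)) : ℝ :=
  ∑ s₁, ν s₁ * ∑ a, first x s₁ (a, q.2) * M.P s₁ a q.1

/-- `ν^P(s, η) = ∑ s₁ a₁, ν(s₁) P(s | s₁, a₁)`. -/
noncomputable def nextMass (M : RiskMDP S A H) (ν : S → ℝ) (q : S × Fin (H + 1)) : ℝ :=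
  ∑ s₁, ∑ a, ν s₁ * M.P s₁ a q.1

section
variable [DecidableEq S]

/-- Value function of the steps `t ≥ 2`: the expected discounted sum of the manipulated costs
along the trajectory that starts in the augmented state `p` and follows `π₂`. -/
noncomputable def Jhat (M : RiskMDP S A H) (x : PolicySpace S A H) (p : S × Fin (H + 1)) : ℝ :=
  ∑' t : ℕ, M.γ ^ t * ∑ q, (M.trans x ^ t) p q * ∑ b, later x q b * M.cbar q b

/-- First-step action-value function
`Q(s, a, η) = C(s,a) + γ lam η + γ E_{s' ∼ P(· | s, a)} [Ĵ(s', η)]`. -/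
noncomputable def Q (M : RiskMDP S A H) (x : PolicySpace S A H) (s : S)
    (b : A × Fin (H + 1)) : ℝ :=
  M.C s b.1 + M.γ * M.lam * (((b.2 : ℕ) : ℝ) / H) + M.γ * ∑ s', M.P s b.1 s' * M.Jhat x (s', b.2)

/-- The objective `J^π(ρ)`. It is given by the same formula on the whole parameter space, so
that its gradient at a policy makes sense. -/
noncomputable def J (M : RiskMDP S A H) (ρ : S → ℝ) (x : PolicySpace S A H) : ℝ :=
  ∑ s, ρ s * ∑ b, first x s b * M.Q x s b

/-- The optimal value `J^*(ρ)`. -/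
noncomputable def Jstar (M : RiskMDP S A H) (ρ : S → ℝ) : ℝ :=
  sInf (M.J ρ '' policies S A H)

/-- `x` is an optimal policy for the initial distribution `ρ`. -/
def IsOptimal (M : RiskMDP S A H) (ρ : S → ℝ) (x : PolicySpace S A H) : Prop :=
  x ∈ policies S A H ∧ IsMinOn (M.J ρ) (policies S A H) x

/-- Discounted visitation distribution of the augmented states with `(s₂, η₂) ∼ ν`:
`d_ν(q) = (1 - γ) ∑ p, ν(p) ∑ t, γ^t Pr((s_{t+2}, η_{t+2}) = q | (s₂, η₂) = p)`. -/
noncomputable def visit (M : RiskMDP S A H) (x : PolicySpace S A H)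
    (ν : S × Fin (H + 1) → ℝ) (q : S × Fin (H + 1)) : ℝ :=
  ∑ p, ν p * ((1 - M.γ) * ∑' t : ℕ, M.γ ^ t * (M.trans x ^ t) p q)

/-- The stepsize `β = (1 - γ)³ / (2 γ |A| |H| ‖c̄‖_∞)`, where the grid has `H + 1` points. -/
noncomputable def stepsize (M : RiskMDP S A H) : ℝ :=
  (1 - M.γ) ^ 3 / (2 * M.γ * Fintype.card A * (H + 1 : ℕ) * M.cbarNorm)

/-- `x 0, x 1, …` are the iterates of projected gradient descent on `π ↦ J^π(μ)` over the
product of simplices, started at an arbitrary policy `x 0`. -/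
def IsProjectedGD (M : RiskMDP S A H) (μ : S → ℝ) (x : ℕ → PolicySpace S A H) : Prop :=
  x 0 ∈ policies S A H ∧
    ∀ t, IsEuclideanProj (policies S A H) (x t - M.stepsize • gradient (M.J μ) (x t)) (x (t + 1))

end

end RiskMDP

/-- `π₁^LB = inf_{t ≥ 1} min_{s, a, η} π₁^{(t)}(a, η | s)`. -/
noncomputable def firstLB {S A : Type*} {H : ℕ} (x : ℕ → PolicySpace S A H) : ℝ :=
  ⨅ i : ℕ × S × A × Fin (H + 1), first (x (i.1 + 1)) i.2.1 i.2.2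

/-- `D₁ = max {‖ρ / μ‖_∞, 1 / ((1 - γ) π₁^LB) ‖d^{π*}_{ρ^{π*}} / μ^P‖_∞}`, in `[0, ∞]`, for the lower
bound `lb` and the policy `y = π*`. -/
noncomputable def RiskMDP.D₁ {S A : Type*} [Fintype S] [Fintype A] [DecidableEq S] {H : ℕ}
    (M : RiskMDP S A H) (ρ μ : S → ℝ) (lb : ℝ) (y : PolicySpace S A H) : ℝ≥0∞ :=
  max (supRatio ρ μ)
    ((ENNReal.ofReal ((1 - M.γ) * lb))⁻¹ *
      supRatio (M.visit y (M.secondDist y ρ)) (M.nextMass μ))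

/-! On the augmented states (s, η) the steps t ≥ 2 form a discounted Markov decision process with
stochastic matrix T, so values and visitation measures are expressed through the resolvent R = (1 -
γT)⁻¹. The performance-difference identities `Jhat_sub` and `J_sub` write J(w) - J(x) as advantages
over x weighted by the visitation of w. Replacing these weights by those of x gives the linear term
`dirDeriv`, with an error of second order (`abs_J_sub_dirDeriv_le`). Its constant is exactly L/4
with L = 1/β. By `fderiv_J_sub` the linear term is the pairing with the gradient.

Projected descent with step 1/L therefore loses at least (3/4)Lδ² of the objective whenever the
iterate moves by δ. As 0 ≤ J ≤ C̄, some step among the first T is short, and after a short step the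
new iterate is nearly stationary (`exists_nearly_stationary_iterate`).

Near stationarity suffices, although J is not convex, by gradient domination
(`exists_J_sub_le_mul_dirDeriv`): the greedy policy z has nonpositive advantage at every state, so
the visitation of π* from ρ may be exchanged for that of the iterate from μ at the price of a factor
D₁. This factor is finite when the iterates' first-step probabilities are bounded below, because the
visitation of an iterate dominates (1-γ) times the law of (s₂, η₂), hence (1-γ) π₁^LB μ^P. -/

open scoped ENNReal

attribute [local instance] Matrix.linftyOpNormedRing Matrix.linftyOpNormedAlgebra

/-! ### The resolvent of the augmented transition matrix -/

namespace RiskMDP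

variable {S A : Type*} [Fintype S] [Fintype A] {H : ℕ}

/-- Expected one-step cost under `π₂`. -/
noncomputable def stepCost (M : RiskMDP S A H) (x : PolicySpace S A H) (q : S × Fin (H + 1)) : ℝ :=
  ∑ b, later x q b * M.cbar q b

theorem trans_mulVec (M : RiskMDP S A H) (x : PolicySpace S A H) (V : S × Fin (H + 1) → ℝ)
    (p : S × Fin (H + 1)) :
    (M.trans x).mulVec V p = ∑ b, later x p b * ∑ s', M.P p.1 b.1 s' * V (s', b.2) := by
  simp only [Matrix.mulVec, dotProduct, trans, Matrix.of_apply, Fintype.sum_prod_type,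
    Finset.sum_mul, Finset.mul_sum]
  calc _ = ∑ s', ∑ a, ∑ h, later x p (a, h) * M.P p.1 a s' * V (s', h) :=
        Finset.sum_congr rfl fun s' _ => Finset.sum_comm
    _ = ∑ a, ∑ s', ∑ h, later x p (a, h) * M.P p.1 a s' * V (s', h) := Finset.sum_comm
    _ = _ := Finset.sum_congr rfl fun _ _ => by
        rw [Finset.sum_comm]
        exact Finset.sum_congr rfl fun h _ => Finset.sum_congr rfl fun s' _ => mul_assoc _ _ _

theorem trans_nonneg (M : RiskMDP S A H) {x : PolicySpace S A H} (hx : x ∈ policies S A H)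
    (p q : S × Fin (H + 1)) : 0 ≤ M.trans x p q :=
  Finset.sum_nonneg fun _ _ => mul_nonneg ((hx.2 p).1 _) ((M.P_mem _ _).1 _)

theorem trans_mulVec_one (M : RiskMDP S A H) {x : PolicySpace S A H} (hx : x ∈ policies S A H) :
    (M.trans x).mulVec 1 = 1 := by
  ext p
  rw [trans_mulVec]
  simp only [Pi.one_apply, mul_one, (M.P_mem _ _).2]
  exact (hx.2 p).2

variable [DecidableEq S]

/-- In the maximal row-sum norm a stochastic matrix has norm at most 1. This makes the Neumann
series converge at every policy. -/
theorem norm_trans_le (M : RiskMDP S A H) {x : PolicySpace S A H} (hx : x ∈ policies S A H) :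
    ‖M.γ • M.trans x‖ ≤ M.γ := by
  have h : ‖M.trans x‖₊ ≤ 1 := by
    rw [Matrix.linfty_opNNNorm_def]
    refine Finset.sup_le fun p _ => ?_
    rw [← NNReal.coe_le_coe]
    push_cast
    have := congrFun (M.trans_mulVec_one hx) p
    simp only [Matrix.mulVec, dotProduct, Pi.one_apply, mul_one] at this
    rw [← this]
    exact Finset.sum_le_sum fun q _ => by rw [Real.norm_of_nonneg (M.trans_nonneg hx p q)]
  rw [norm_smul, Real.norm_of_nonneg M.γ_pos.le]
  exact mul_le_of_le_one_right M.γ_pos.le h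

/-- The resolvent `∑ t, γ^t T^t = (1 - γ T)⁻¹` of the augmented transition matrix. -/
noncomputable def resolvent (M : RiskMDP S A H) (x : PolicySpace S A H) :
    Matrix (S × Fin (H + 1)) (S × Fin (H + 1)) ℝ :=
  ∑' t : ℕ, (M.γ • M.trans x) ^ t

theorem hasSum_resolvent_apply (M : RiskMDP S A H) {x : PolicySpace S A H}
    (hx : ‖M.γ • M.trans x‖ < 1) (p q : S × Fin (H + 1)) :
    HasSum (fun t : ℕ => M.γ ^ t * (M.trans x ^ t) p q) (M.resolvent x p q) := by
  have h := (summable_geometric_of_norm_lt_one hx).hasSum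
  have h2 : HasSum (fun t : ℕ => ((M.γ • M.trans x) ^ t) p q) (M.resolvent x p q) :=
    Pi.hasSum.1 (Pi.hasSum.1 h p) q
  have h3 : (fun t : ℕ => ((M.γ • M.trans x) ^ t) p q) =
      fun t => M.γ ^ t * (M.trans x ^ t) p q :=
    funext fun t => by rw [smul_pow, Matrix.smul_apply, smul_eq_mul]
  rwa [h3] at h2

theorem Jhat_eq_resolvent (M : RiskMDP S A H) {x : PolicySpace S A H}
    (hx : ‖M.γ • M.trans x‖ < 1) (p : S × Fin (H + 1)) :
    M.Jhat x p = (M.resolvent x).mulVec (M.stepCost x) p := by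
  have h : HasSum (fun t : ℕ => ∑ q, M.γ ^ t * (M.trans x ^ t) p q * M.stepCost x q)
      (∑ q, M.resolvent x p q * M.stepCost x q) :=
    hasSum_sum fun q _ => (M.hasSum_resolvent_apply hx p q).mul_right _
  rw [Matrix.mulVec, dotProduct, ← h.tsum_eq]
  simp only [Jhat, stepCost, Finset.mul_sum, mul_assoc]

theorem visit_eq_resolvent (M : RiskMDP S A H) {x : PolicySpace S A H}
    (hx : ‖M.γ • M.trans x‖ < 1) (ν : S × Fin (H + 1) → ℝ) (q : S × Fin (H + 1)) :
    M.visit x ν q = (1 - M.γ) * ∑ p, ν p * M.resolvent x p q := by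
  simp only [visit, (M.hasSum_resolvent_apply hx _ q).tsum_eq, Finset.mul_sum]
  exact Finset.sum_congr rfl fun p _ => by ring

theorem resolvent_mul (M : RiskMDP S A H) {x : PolicySpace S A H}
    (hx : ‖M.γ • M.trans x‖ < 1) : M.resolvent x * (1 - M.γ • M.trans x) = 1 :=
  geom_series_mul_neg _ hx

theorem mul_resolvent (M : RiskMDP S A H) {x : PolicySpace S A H}
    (hx : ‖M.γ • M.trans x‖ < 1) : (1 - M.γ • M.trans x) * M.resolvent x = 1 :=
  mul_neg_geom_series _ hx

/-- This form makes the resolvent differentiable in the parameters without differentiating a series.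
-/
theorem resolvent_eq_inverse (M : RiskMDP S A H) {x : PolicySpace S A H}
    (hx : ‖M.γ • M.trans x‖ < 1) : M.resolvent x = Ring.inverse (1 - M.γ • M.trans x) := by
  rw [NormedRing.inverse_one_sub _ hx]; rfl

theorem norm_lt_one (M : RiskMDP S A H) {x : PolicySpace S A H} (hx : x ∈ policies S A H) :
    ‖M.γ • M.trans x‖ < 1 :=
  (M.norm_trans_le hx).trans_lt M.γ_lt_one

/-- `V = R v` if `V - γ T V = v`. -/
theorem eq_resolvent_mulVec (M : RiskMDP S A H) {x : PolicySpace S A H} (hx : x ∈ policies S A H)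
    {V v : S × Fin (H + 1) → ℝ} (h : ∀ p, V p - M.γ * (M.trans x).mulVec V p = v p) :
    V = (M.resolvent x).mulVec v := by
  have h' : (1 - M.γ • M.trans x).mulVec V = v := by
    ext p
    simp [Matrix.sub_mulVec, Matrix.smul_mulVec, ← h p]
  rw [← h', Matrix.mulVec_mulVec, M.resolvent_mul (M.norm_lt_one hx), Matrix.one_mulVec]

theorem resolvent_mulVec_sub (M : RiskMDP S A H) {x : PolicySpace S A H}
    (hx : x ∈ policies S A H) (v : S × Fin (H + 1) → ℝ) (p : S × Fin (H + 1)) :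
    (M.resolvent x).mulVec v p
      - M.γ * (M.trans x).mulVec ((M.resolvent x).mulVec v) p = v p := by
  have h : (1 - M.γ • M.trans x).mulVec ((M.resolvent x).mulVec v) = v := by
    rw [Matrix.mulVec_mulVec, M.mul_resolvent (M.norm_lt_one hx), Matrix.one_mulVec]
  have := congrFun h p
  rwa [Matrix.sub_mulVec, Matrix.one_mulVec, Pi.sub_apply, Matrix.smul_mulVec, Pi.smul_apply,
    smul_eq_mul] at this

theorem resolvent_nonneg (M : RiskMDP S A H) {x : PolicySpace S A H} (hx : x ∈ policies S A H)
    (p q : S × Fin (H + 1)) : 0 ≤ M.resolvent x p q := by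
  have hT : M.trans x ∈ Matrix.rowStochastic ℝ (S × Fin (H + 1)) :=
    ⟨M.trans_nonneg hx, M.trans_mulVec_one hx⟩
  exact (M.hasSum_resolvent_apply (M.norm_lt_one hx) p q).nonneg fun t =>
    mul_nonneg (pow_nonneg M.γ_pos.le t)
      (Matrix.nonneg_of_mem_rowStochastic (pow_mem hT t))

/-- The constant 1/(1-γ) solves V - γTV = 1, because T fixes constants. -/
theorem sum_resolvent (M : RiskMDP S A H) {x : PolicySpace S A H} (hx : x ∈ policies S A H)
    (p : S × Fin (H + 1)) : ∑ q, M.resolvent x p q = 1 / (1 - M.γ) := by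
  have h0 : 1 - M.γ ≠ 0 := (sub_pos.2 M.γ_lt_one).ne'
  have h : (fun _ : S × Fin (H + 1) => 1 / (1 - M.γ)) = (M.resolvent x).mulVec 1 := by
    refine M.eq_resolvent_mulVec hx fun p => ?_
    have : (fun _ : S × Fin (H + 1) => 1 / (1 - M.γ)) = (1 / (1 - M.γ)) • 1 := by ext; simp
    rw [this, Matrix.mulVec_smul, M.trans_mulVec_one hx]
    simp only [Pi.smul_apply, Pi.one_apply, smul_eq_mul, mul_one]
    field_simp
  have := congrFun h p
  simpa [Matrix.mulVec, dotProduct] using this.symm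

theorem abs_resolvent_mulVec_le (M : RiskMDP S A H) {x : PolicySpace S A H}
    (hx : x ∈ policies S A H) {v : S × Fin (H + 1) → ℝ} {B : ℝ} (hv : ∀ q, |v q| ≤ B)
    (p : S × Fin (H + 1)) : |(M.resolvent x).mulVec v p| ≤ B / (1 - M.γ) := by
  rw [Matrix.mulVec, dotProduct]
  calc |∑ q, M.resolvent x p q * v q| ≤ ∑ q, |M.resolvent x p q * v q| :=
        Finset.abs_sum_le_sum_abs _ _
    _ ≤ ∑ q, M.resolvent x p q * B := Finset.sum_le_sum fun q _ => by
        rw [abs_mul, abs_of_nonneg (M.resolvent_nonneg hx p q)]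
        exact mul_le_mul_of_nonneg_left (hv q) (M.resolvent_nonneg hx p q)
    _ = B / (1 - M.γ) := by rw [← Finset.sum_mul, M.sum_resolvent hx]; ring

theorem resolvent_mulVec_nonneg (M : RiskMDP S A H) {x : PolicySpace S A H}
    (hx : x ∈ policies S A H) {v : S × Fin (H + 1) → ℝ} (hv : ∀ q, 0 ≤ v q)
    (p : S × Fin (H + 1)) : 0 ≤ (M.resolvent x).mulVec v p :=
  Finset.sum_nonneg fun q _ => mul_nonneg (M.resolvent_nonneg hx p q) (hv q)

/-- The term t = 0 of the series contributes 1 and the others are nonnegative. -/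
theorem one_le_resolvent_diag (M : RiskMDP S A H) {x : PolicySpace S A H}
    (hx : x ∈ policies S A H) (p : S × Fin (H + 1)) : 1 ≤ M.resolvent x p p := by
  have hT : M.trans x ∈ Matrix.rowStochastic ℝ (S × Fin (H + 1)) :=
    ⟨M.trans_nonneg hx, M.trans_mulVec_one hx⟩
  have h := le_hasSum (M.hasSum_resolvent_apply (M.norm_lt_one hx) p p) 0 fun t _ =>
    mul_nonneg (pow_nonneg M.γ_pos.le t) (Matrix.nonneg_of_mem_rowStochastic (pow_mem hT t))
  simpa using h

end RiskMDP

/-! ### Sums against probability vectors and mean-zero weights -/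

/-- Mean-zero weights do not see constants, so f may be recentred at B/2. The factor 1/2 gained here
is needed for the curvature to match the given stepsize. -/
theorem abs_sum_mul_le_half {ι : Type*} [Fintype ι] {u f : ι → ℝ} {B : ℝ} (hu : ∑ i, u i = 0)
    (h0 : ∀ i, 0 ≤ f i) (hB : ∀ i, f i ≤ B) : |∑ i, u i * f i| ≤ (∑ i, |u i|) * (B / 2) := by
  have h : ∑ i, u i * f i = ∑ i, u i * (f i - B / 2) := by
    simp only [mul_sub, Finset.sum_sub_distrib, ← Finset.sum_mul, hu, zero_mul, sub_zero]
  rw [h, Finset.sum_mul]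
  refine (Finset.abs_sum_le_sum_abs _ _).trans (Finset.sum_le_sum fun i _ => ?_)
  rw [abs_mul]
  refine mul_le_mul_of_nonneg_left (abs_le.2 ⟨?_, ?_⟩) (abs_nonneg _)
  · linarith [h0 i]
  · linarith [hB i]

theorem abs_sum_mul_le_of_abs_le {ι : Type*} [Fintype ι] {u f : ι → ℝ} {B : ℝ}
    (hB : ∀ i, |f i| ≤ B) : |∑ i, u i * f i| ≤ (∑ i, |u i|) * B := by
  rw [Finset.sum_mul]
  refine (Finset.abs_sum_le_sum_abs _ _).trans (Finset.sum_le_sum fun i _ => ?_)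
  rw [abs_mul]
  exact mul_le_mul_of_nonneg_left (hB i) (abs_nonneg _)

theorem abs_sum_mul_le_of_mem_stdSimplex {ι : Type*} [Fintype ι] {p f : ι → ℝ} {B : ℝ}
    (hp : p ∈ stdSimplex ℝ ι) (hB : ∀ i, |f i| ≤ B) : |∑ i, p i * f i| ≤ B := by
  refine (abs_sum_mul_le_of_abs_le hB).trans_eq ?_
  simp only [abs_of_nonneg (hp.1 _), hp.2, one_mul]

theorem sum_mul_le_of_mem_stdSimplex {ι : Type*} [Fintype ι] {p f : ι → ℝ} {B : ℝ}
    (hp : p ∈ stdSimplex ℝ ι) (hB : ∀ i, f i ≤ B) : ∑ i, p i * f i ≤ B := by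
  calc ∑ i, p i * f i ≤ ∑ i, p i * B :=
        Finset.sum_le_sum fun i _ => mul_le_mul_of_nonneg_left (hB i) (hp.1 i)
    _ = B := by rw [← Finset.sum_mul, hp.2, one_mul]

theorem sum_mul_nonneg_of_mem_stdSimplex {ι : Type*} [Fintype ι] {p f : ι → ℝ}
    (hp : p ∈ stdSimplex ℝ ι) (hf : ∀ i, 0 ≤ f i) : 0 ≤ ∑ i, p i * f i :=
  Finset.sum_nonneg fun i _ => mul_nonneg (hp.1 i) (hf i)

/-! ### Bounds on values and performance differences -/

namespace RiskMDP

variable {S A : Type*} [Fintype S] {H : ℕ}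

theorem grid_nonneg (h : Fin (H + 1)) : (0 : ℝ) ≤ ((h : ℕ) : ℝ) / H := by positivity

theorem grid_le_one (M : RiskMDP S A H) (h : Fin (H + 1)) : ((h : ℕ) : ℝ) / H ≤ 1 := by
  have hH : (0 : ℝ) < H := by exact_mod_cast M.H_pos
  rw [div_le_one hH]
  exact_mod_cast Nat.lt_succ_iff.1 h.2

theorem one_le_lam_div_add (M : RiskMDP S A H) : 1 ≤ M.lam / M.α + (1 - M.lam) := by
  have : M.lam ≤ M.lam / M.α := by
    rw [le_div_iff₀ M.α_pos]
    exact mul_le_of_le_one_right M.lam_nonneg M.α_lt_one.le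
  linarith

theorem cbar_nonneg (M : RiskMDP S A H) (p : S × Fin (H + 1)) (b : A × Fin (H + 1)) :
    0 ≤ M.cbar p b := by
  have h1 := M.lam_nonneg
  have h2 := M.α_pos
  have h3 := M.γ_pos
  have h4 := sub_nonneg.2 M.lam_le_one
  have h5 := M.C_nonneg p.1 b.1
  unfold cbar
  positivity

theorem one_le_cbarNorm (M : RiskMDP S A H) : 1 ≤ M.cbarNorm := by
  have h := M.one_le_lam_div_add
  have := mul_nonneg M.γ_pos.le M.lam_nonneg
  unfold cbarNorm
  linarith

theorem cbar_le (M : RiskMDP S A H) (p : S × Fin (H + 1)) (b : A × Fin (H + 1)) :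
    M.cbar p b ≤ M.cbarNorm := by
  have h1 := M.lam_nonneg
  have h2 := M.α_pos
  have h3 := M.γ_pos
  have h4 := sub_nonneg.2 M.lam_le_one
  have h5 := M.C_le_one p.1 b.1
  have h6 := grid_nonneg p.2
  unfold cbar cbarNorm
  refine add_le_add (add_le_add ?_ (mul_le_of_le_one_right h4 h5)) ?_
  · exact mul_le_of_le_one_right (by positivity) (max_le (by linarith) zero_le_one)
  · exact mul_le_of_le_one_right (by positivity) (M.grid_le_one b.2)

variable [Fintype A]

theorem sum_secondDist_mul (M : RiskMDP S A H) (x : PolicySpace S A H) (ν : S → ℝ)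
    (V : S × Fin (H + 1) → ℝ) :
    ∑ q, M.secondDist x ν q * V q =
      ∑ s, ν s * ∑ b, first x s b * ∑ s', M.P s b.1 s' * V (s', b.2) := by
  simp only [secondDist, Finset.sum_mul]
  rw [Finset.sum_comm]
  refine Finset.sum_congr rfl fun s _ => ?_
  simp only [mul_assoc, ← Finset.mul_sum]
  congr 1
  simp only [Finset.sum_mul, Finset.mul_sum, Fintype.sum_prod_type, mul_assoc]
  calc _ = ∑ s', ∑ a, ∑ h, first x s (a, h) * (M.P s a s' * V (s', h)) :=
        Finset.sum_congr rfl fun s' _ => Finset.sum_comm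
    _ = ∑ a, ∑ s', ∑ h, first x s (a, h) * (M.P s a s' * V (s', h)) := Finset.sum_comm
    _ = _ := Finset.sum_congr rfl fun _ _ => Finset.sum_comm

variable [DecidableEq S]

/-- Action-value function of the steps `t ≥ 2`. -/
noncomputable def Qhat (M : RiskMDP S A H) (x : PolicySpace S A H) (q : S × Fin (H + 1))
    (b : A × Fin (H + 1)) : ℝ :=
  M.cbar q b + M.γ * ∑ s', M.P q.1 b.1 s' * M.Jhat x (s', b.2)

/-- Both sides are the value of following w for one step and x afterwards. The case w = x is the
Bellman equation; the general case produces advantages. -/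
theorem stepCost_add_trans (M : RiskMDP S A H) (x w : PolicySpace S A H) (p : S × Fin (H + 1)) :
    M.stepCost w p + M.γ * (M.trans w).mulVec (M.Jhat x) p =
      ∑ b, later w p b * M.Qhat x p b := by
  rw [trans_mulVec, stepCost, Finset.mul_sum, ← Finset.sum_add_distrib]
  exact Finset.sum_congr rfl fun b _ => by rw [Qhat]; ring

theorem Jhat_bellman (M : RiskMDP S A H) {x : PolicySpace S A H} (hx : x ∈ policies S A H)
    (p : S × Fin (H + 1)) : M.Jhat x p = ∑ b, later x p b * M.Qhat x p b := by
  rw [← stepCost_add_trans]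
  have h := M.resolvent_mulVec_sub hx (M.stepCost x) p
  rw [← funext (M.Jhat_eq_resolvent (M.norm_lt_one hx))] at h
  linarith

theorem Jhat_nonneg (M : RiskMDP S A H) {x : PolicySpace S A H} (hx : x ∈ policies S A H)
    (p : S × Fin (H + 1)) : 0 ≤ M.Jhat x p := by
  rw [M.Jhat_eq_resolvent (M.norm_lt_one hx)]
  exact M.resolvent_mulVec_nonneg hx
    (fun q => sum_mul_nonneg_of_mem_stdSimplex (hx.2 q) (M.cbar_nonneg q)) p

theorem Jhat_le (M : RiskMDP S A H) {x : PolicySpace S A H} (hx : x ∈ policies S A H)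
    (p : S × Fin (H + 1)) : M.Jhat x p ≤ M.cbarNorm / (1 - M.γ) := by
  rw [M.Jhat_eq_resolvent (M.norm_lt_one hx)]
  refine (le_abs_self _).trans (M.abs_resolvent_mulVec_le hx (fun q => ?_) p)
  exact abs_sum_mul_le_of_mem_stdSimplex (hx.2 q)
    fun b => by rw [abs_of_nonneg (M.cbar_nonneg q b)]; exact M.cbar_le q b

theorem Qhat_nonneg (M : RiskMDP S A H) {x : PolicySpace S A H} (hx : x ∈ policies S A H)
    (p : S × Fin (H + 1)) (b : A × Fin (H + 1)) : 0 ≤ M.Qhat x p b :=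
  add_nonneg (M.cbar_nonneg p b) (mul_nonneg M.γ_pos.le
    (sum_mul_nonneg_of_mem_stdSimplex (M.P_mem _ _) fun _ => M.Jhat_nonneg hx _))

theorem Qhat_le (M : RiskMDP S A H) {x : PolicySpace S A H} (hx : x ∈ policies S A H)
    (p : S × Fin (H + 1)) (b : A × Fin (H + 1)) : M.Qhat x p b ≤ M.cbarNorm / (1 - M.γ) := by
  have h1 := M.cbar_le p b
  have h2 : ∑ s', M.P p.1 b.1 s' * M.Jhat x (s', b.2) ≤ M.cbarNorm / (1 - M.γ) :=
    sum_mul_le_of_mem_stdSimplex (M.P_mem _ _) fun _ => M.Jhat_le hx _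
  have h3 := mul_le_mul_of_nonneg_left h2 M.γ_pos.le
  have h0 : 0 < 1 - M.γ := sub_pos.2 M.γ_lt_one
  have h4 : M.cbarNorm + M.γ * (M.cbarNorm / (1 - M.γ)) = M.cbarNorm / (1 - M.γ) := by
    field_simp; ring
  unfold Qhat
  linarith

theorem J_nonneg (M : RiskMDP S A H) {ρ : S → ℝ} (hρ : ρ ∈ stdSimplex ℝ S)
    {x : PolicySpace S A H} (hx : x ∈ policies S A H) : 0 ≤ M.J ρ x :=
  sum_mul_nonneg_of_mem_stdSimplex hρ fun s => sum_mul_nonneg_of_mem_stdSimplex (hx.1 s) fun b => by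
    have h1 := M.lam_nonneg
    have h3 := M.γ_pos
    have h5 := M.C_nonneg s b.1
    have h6 : 0 ≤ ∑ s', M.P s b.1 s' * M.Jhat x (s', b.2) :=
      sum_mul_nonneg_of_mem_stdSimplex (M.P_mem _ _) fun _ => M.Jhat_nonneg hx _
    unfold Q
    positivity

/-- Since 1 + γλ ≤ ‖c̄‖_∞, already ‖c̄‖_∞/(1-γ) is an upper bound; the other terms of C̄ are slack.
-/
theorem J_le_Cbar (M : RiskMDP S A H) {ρ : S → ℝ} (hρ : ρ ∈ stdSimplex ℝ S)
    {x : PolicySpace S A H} (hx : x ∈ policies S A H) : M.J ρ x ≤ M.Cbar := by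
  refine sum_mul_le_of_mem_stdSimplex hρ fun s => sum_mul_le_of_mem_stdSimplex (hx.1 s) fun b => ?_
  have h0 : 0 < 1 - M.γ := sub_pos.2 M.γ_lt_one
  have h2 : ∑ s', M.P s b.1 s' * M.Jhat x (s', b.2) ≤ M.cbarNorm / (1 - M.γ) :=
    sum_mul_le_of_mem_stdSimplex (M.P_mem _ _) fun _ => M.Jhat_le hx _
  have h3 := mul_le_mul_of_nonneg_left h2 M.γ_pos.le
  have h4 : M.cbarNorm + M.γ * (M.cbarNorm / (1 - M.γ)) = 1 / (1 - M.γ) * M.cbarNorm := by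
    field_simp; ring
  have h5 := M.C_le_one s b.1
  have h6 : M.γ * M.lam * (((b.2 : ℕ) : ℝ) / H) ≤ M.γ * M.lam :=
    mul_le_of_le_one_right (mul_nonneg M.γ_pos.le M.lam_nonneg) (M.grid_le_one b.2)
  have h7 := M.one_le_lam_div_add
  have h8 : 0 ≤ M.lam / M.α := div_nonneg M.lam_nonneg M.α_pos.le
  have h9 := M.lam_nonneg
  have h10 : M.cbarNorm = M.lam / M.α + (1 - M.lam) + M.γ * M.lam := rfl
  unfold Q Cbar
  linarith

/-- The advantage `∑ b, (π'₂ - π₂)(b | q) Q̂^π(q, b)` of `w` over `x`. -/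
noncomputable def adv (M : RiskMDP S A H) (x w : PolicySpace S A H) (q : S × Fin (H + 1)) : ℝ :=
  ∑ b, (later w q b - later x q b) * M.Qhat x q b

/-- The first-step advantage `∑ b, (π'₁ - π₁)(b | s) Q^π(s, b)` of `w` over `x`. -/
noncomputable def advFirst (M : RiskMDP S A H) (x w : PolicySpace S A H) (s : S) : ℝ :=
  ∑ b, (first w s b - first x s b) * M.Q x s b

/-- Performance difference: V = Ĵ^w - Ĵ^x satisfies V - γ T_w V = `adv`, by the Bellman equations
for both policies. -/
theorem Jhat_sub (M : RiskMDP S A H) {x w : PolicySpace S A H} (hx : x ∈ policies S A H)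
    (hw : w ∈ policies S A H) :
    M.Jhat w - M.Jhat x = (M.resolvent w).mulVec (M.adv x w) := by
  refine M.eq_resolvent_mulVec hw fun p => ?_
  have h1 := M.Jhat_bellman hw p
  have h2 := M.Jhat_bellman hx p
  rw [← stepCost_add_trans] at h1
  have h3 := M.stepCost_add_trans x w p
  simp only [Matrix.mulVec_sub, Pi.sub_apply, adv, sub_mul, Finset.sum_sub_distrib]
  linarith

/-- The change splits into that of π₁ against the action values of x, and that of the continuation
values under the first step of w. -/
theorem J_sub (M : RiskMDP S A H) (ρ : S → ℝ) (x w : PolicySpace S A H) :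
    M.J ρ w - M.J ρ x = ∑ s, ρ s * M.advFirst x w s
      + M.γ * ∑ q, M.secondDist w ρ q * (M.Jhat w - M.Jhat x) q := by
  rw [sum_secondDist_mul]
  simp only [J, advFirst, ← Finset.sum_sub_distrib, Finset.mul_sum, ← Finset.sum_add_distrib]
  refine Finset.sum_congr rfl fun s _ => Finset.sum_congr rfl fun b _ => ?_
  simp only [Q, Pi.sub_apply, mul_sub, Finset.sum_sub_distrib, ← Finset.mul_sum]
  ring

/-- The directional derivative of the objective at the policy `x` in the direction `w - x`. -/
noncomputable def dirDeriv (M : RiskMDP S A H) (ρ : S → ℝ) (x w : PolicySpace S A H) : ℝ :=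
  ∑ s, ρ s * M.advFirst x w s
    + M.γ * ∑ q, M.secondDist x ρ q * (M.resolvent x).mulVec (M.adv x w) q

/-- Resolvent identity R_w - R_x = R_w γ(T_w - T_x) R_x. -/
theorem resolvent_sub_mulVec (M : RiskMDP S A H) {x w : PolicySpace S A H}
    (hx : x ∈ policies S A H) (hw : w ∈ policies S A H) (v : S × Fin (H + 1) → ℝ) :
    (M.resolvent w).mulVec v - (M.resolvent x).mulVec v =
      (M.resolvent w).mulVec
        (M.γ • (M.trans w - M.trans x).mulVec ((M.resolvent x).mulVec v)) := by
  refine M.eq_resolvent_mulVec hw fun p => ?_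
  have h1 := M.resolvent_mulVec_sub hw v p
  have h2 := M.resolvent_mulVec_sub hx v p
  simp only [Matrix.mulVec_sub, Matrix.sub_mulVec, Pi.sub_apply, Pi.smul_apply, smul_eq_mul]
  linarith

end RiskMDP

/-! ### Geometry of the product of simplices -/

section Policies

variable {S A : Type*} [Fintype A] {H : ℕ}

theorem convex_policies : Convex ℝ (policies S A H) := fun _ hx _ hy _ _ ha hb hab =>
  ⟨fun s => convex_stdSimplex ℝ _ (hx.1 s) (hy.1 s) ha hb hab,
    fun p => convex_stdSimplex ℝ _ (hx.2 p) (hy.2 p) ha hb hab⟩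

variable [Fintype S]

theorem norm_sq_policySpace (u : PolicySpace S A H) :
    ‖u‖ ^ 2 = ∑ s, ∑ b, first u s b ^ 2 + ∑ p, ∑ b, later u p b ^ 2 := by
  rw [EuclideanSpace.real_norm_sq_eq, Fintype.sum_sum_type]
  simp only [Fintype.sum_prod_type, first, later]

/-- Cauchy–Schwarz over the |A||H| entries of a block. Two uses of it produce the factor |A||H| of
the stepsize. -/
theorem sum_abs_le_sqrt_card_mul {u : A × Fin (H + 1) → ℝ} {r : ℝ} (hr : 0 ≤ r)
    (hu : ∑ b, u b ^ 2 ≤ r ^ 2) :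
    ∑ b, |u b| ≤ √(Fintype.card A * (H + 1 : ℕ)) * r := by
  refine abs_le_of_sq_le_sq' ?_ (by positivity) |>.2
  rw [mul_pow, Real.sq_sqrt (by positivity)]
  refine sq_sum_le_card_mul_sum_sq.trans ?_
  simp only [sq_abs, Finset.card_univ, Fintype.card_prod, Fintype.card_fin]
  push_cast
  gcongr

theorem sum_abs_first_le (u : PolicySpace S A H) (s : S) :
    ∑ b, |first u s b| ≤ √(Fintype.card A * (H + 1 : ℕ)) * ‖u‖ := by
  refine sum_abs_le_sqrt_card_mul (norm_nonneg _) ?_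
  rw [norm_sq_policySpace]
  refine le_add_of_le_of_nonneg ?_ (by positivity)
  exact Finset.single_le_sum (f := fun s => ∑ b, first u s b ^ 2) (fun _ _ => by positivity)
    (Finset.mem_univ s)

theorem sum_abs_later_le (u : PolicySpace S A H) (p : S × Fin (H + 1)) :
    ∑ b, |later u p b| ≤ √(Fintype.card A * (H + 1 : ℕ)) * ‖u‖ := by
  refine sum_abs_le_sqrt_card_mul (norm_nonneg _) ?_
  rw [norm_sq_policySpace]
  refine le_add_of_nonneg_of_le (by positivity) ?_
  exact Finset.single_le_sum (f := fun p => ∑ b, later u p b ^ 2) (fun _ _ => by positivity)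
    (Finset.mem_univ p)

theorem sum_sub_sq_le_two {ι : Type*} [Fintype ι] {p q : ι → ℝ} (hp : p ∈ stdSimplex ℝ ι)
    (hq : q ∈ stdSimplex ℝ ι) : ∑ i, (p i - q i) ^ 2 ≤ 2 := by
  have h : ∀ i, (p i - q i) ^ 2 ≤ p i + q i := fun i => by
    have h1 := hp.1 i
    have h2 := hq.1 i
    have h3 : p i ≤ 1 := hp.2 ▸ Finset.single_le_sum (fun j _ => hp.1 j) (Finset.mem_univ i)
    have h4 : q i ≤ 1 := hq.2 ▸ Finset.single_le_sum (fun j _ => hq.1 j) (Finset.mem_univ i)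
    nlinarith [mul_nonneg h1 h2]
  calc ∑ i, (p i - q i) ^ 2 ≤ ∑ i, (p i + q i) := Finset.sum_le_sum fun i _ => h i
    _ = 2 := by rw [Finset.sum_add_distrib, hp.2, hq.2]; norm_num

/-- Each of the |S|(H+2) simplices has squared diameter at most 2, and 2(H+2) ≤ 4(H+1). -/
theorem norm_sub_sq_le_of_mem_policies (hH : 0 < H) {x y : PolicySpace S A H}
    (hx : x ∈ policies S A H) (hy : y ∈ policies S A H) :
    ‖x - y‖ ^ 2 ≤ 4 * Fintype.card S * (H + 1 : ℕ) := by
  rw [norm_sq_policySpace]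
  have h1 : ∑ s, ∑ b, first (x - y) s b ^ 2 ≤ ∑ _s : S, (2 : ℝ) :=
    Finset.sum_le_sum fun s _ => sum_sub_sq_le_two (hx.1 s) (hy.1 s)
  have h2 : ∑ p, ∑ b, later (x - y) p b ^ 2 ≤ ∑ _p : S × Fin (H + 1), (2 : ℝ) :=
    Finset.sum_le_sum fun p _ => sum_sub_sq_le_two (hx.2 p) (hy.2 p)
  simp only [Finset.sum_const, Finset.card_univ, Fintype.card_prod, Fintype.card_fin,
    nsmul_eq_mul] at h1 h2
  push_cast at h1 h2 ⊢
  have h3 : (0 : ℝ) ≤ Fintype.card S := by positivity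
  have h4 : (0 : ℝ) ≤ H := by positivity
  nlinarith [mul_nonneg h3 h4]

end Policies

/-! ### First-order expansion and differentiability of the objective -/

namespace RiskMDP

variable {S A : Type*} [Fintype S] [Fintype A] {H : ℕ}

theorem abs_sum_secondDist_mul_le (M : RiskMDP S A H) {ρ : S → ℝ} (hρ : ρ ∈ stdSimplex ℝ S)
    {x : PolicySpace S A H} (hx : x ∈ policies S A H) {V : S × Fin (H + 1) → ℝ} {B : ℝ}
    (hV : ∀ q, |V q| ≤ B) : |∑ q, M.secondDist x ρ q * V q| ≤ B := by
  rw [sum_secondDist_mul]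
  exact abs_sum_mul_le_of_mem_stdSimplex hρ fun s => abs_sum_mul_le_of_mem_stdSimplex (hx.1 s)
    fun b => abs_sum_mul_le_of_mem_stdSimplex (M.P_mem _ _) fun _ => hV _

theorem abs_sum_secondDist_sub_le (M : RiskMDP S A H) {ρ : S → ℝ} (hρ : ρ ∈ stdSimplex ℝ S)
    (x w : PolicySpace S A H) {V : S × Fin (H + 1) → ℝ} {B : ℝ} (hB : 0 ≤ B)
    (hV : ∀ q, |V q| ≤ B) :
    |∑ q, M.secondDist w ρ q * V q - ∑ q, M.secondDist x ρ q * V q|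
      ≤ √(Fintype.card A * (H + 1 : ℕ)) * ‖w - x‖ * B := by
  simp only [sum_secondDist_mul, ← Finset.sum_sub_distrib, ← mul_sub, ← sub_mul]
  refine abs_sum_mul_le_of_mem_stdSimplex hρ fun s => ?_
  refine (abs_sum_mul_le_of_abs_le fun b =>
    abs_sum_mul_le_of_mem_stdSimplex (M.P_mem _ _) fun _ => hV _).trans ?_
  exact mul_le_mul_of_nonneg_right (sum_abs_first_le (w - x) s) hB

theorem abs_trans_sub_mulVec_le (M : RiskMDP S A H) (x w : PolicySpace S A H)
    {V : S × Fin (H + 1) → ℝ} {B : ℝ} (hB : 0 ≤ B) (hV : ∀ q, |V q| ≤ B)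
    (p : S × Fin (H + 1)) :
    |(M.trans w - M.trans x).mulVec V p| ≤ √(Fintype.card A * (H + 1 : ℕ)) * ‖w - x‖ * B := by
  rw [Matrix.sub_mulVec, Pi.sub_apply, trans_mulVec, trans_mulVec]
  simp only [← Finset.sum_sub_distrib, ← sub_mul]
  refine (abs_sum_mul_le_of_abs_le fun b =>
    abs_sum_mul_le_of_mem_stdSimplex (M.P_mem _ _) fun _ => hV _).trans ?_
  exact mul_le_mul_of_nonneg_right (sum_abs_later_le (w - x) p) hB

/-- The transition matrix as a linear function of the parameters. -/
noncomputable def transLinear (M : RiskMDP S A H) :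
    PolicySpace S A H →ₗ[ℝ] Matrix (S × Fin (H + 1)) (S × Fin (H + 1)) ℝ where
  toFun := M.trans
  map_add' x y := by
    ext p q
    simp [trans, later, add_mul, Finset.sum_add_distrib]
  map_smul' c x := by
    ext p q
    simp [trans, later, mul_assoc, Finset.mul_sum]

theorem differentiable_trans (M : RiskMDP S A H) : Differentiable ℝ M.trans :=
  M.transLinear.toContinuousLinearMap.differentiable

/-- The quadratic error constant of the first-order expansion of the objective. -/
noncomputable def curvature (M : RiskMDP S A H) : ℝ :=
  M.γ * (Fintype.card A * (H + 1 : ℕ)) * M.cbarNorm / (2 * (1 - M.γ) ^ 3)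

variable [DecidableEq S]

theorem abs_adv_le (M : RiskMDP S A H) {x w : PolicySpace S A H} (hx : x ∈ policies S A H)
    (hw : w ∈ policies S A H) (q : S × Fin (H + 1)) :
    |M.adv x w q| ≤
      √(Fintype.card A * (H + 1 : ℕ)) * ‖w - x‖ * (M.cbarNorm / (1 - M.γ) / 2) := by
  have h0 : 0 < 1 - M.γ := sub_pos.2 M.γ_lt_one
  have h1 := M.one_le_cbarNorm
  refine (abs_sum_mul_le_half ?_ (M.Qhat_nonneg hx q) (M.Qhat_le hx q)).trans ?_
  · rw [Finset.sum_sub_distrib, (hw.2 q).2, (hx.2 q).2, sub_self]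
  · exact mul_le_mul_of_nonneg_right (sum_abs_later_le (w - x) q) (by positivity)

theorem abs_J_sub_dirDeriv_le (M : RiskMDP S A H) {ρ : S → ℝ} (hρ : ρ ∈ stdSimplex ℝ S)
    {x w : PolicySpace S A H} (hx : x ∈ policies S A H) (hw : w ∈ policies S A H) :
    |M.J ρ w - M.J ρ x - M.dirDeriv ρ x w| ≤ M.curvature * ‖w - x‖ ^ 2 := by
  have h0 : 0 < 1 - M.γ := sub_pos.2 M.γ_lt_one
  have hγ := M.γ_pos
  have hcn := M.one_le_cbarNorm
  set N : ℝ := Fintype.card A * (H + 1 : ℕ) with hN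
  have hN0 : 0 ≤ N := by positivity
  set κ : ℝ := √N * ‖w - x‖ with hκ
  set B : ℝ := κ * (M.cbarNorm / (1 - M.γ) / 2) / (1 - M.γ) with hB
  have hB0 : 0 ≤ B := by positivity
  set h := (M.resolvent x).mulVec (M.adv x w) with hh
  have hhB : ∀ q, |h q| ≤ B := M.abs_resolvent_mulVec_le hx (M.abs_adv_le hx hw)
  -- Each error term is a product of two first-order quantities: `adv` times the change of the
  -- resolvent, or of the law of (s₂, η₂).
  have key : M.J ρ w - M.J ρ x - M.dirDeriv ρ x w =
      M.γ * ∑ q, M.secondDist w ρ q * ((M.resolvent w).mulVec (M.adv x w) - h) q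
      + M.γ * (∑ q, M.secondDist w ρ q * h q - ∑ q, M.secondDist x ρ q * h q) := by
    rw [J_sub, dirDeriv, M.Jhat_sub hx hw]
    simp only [Pi.sub_apply, mul_sub, Finset.sum_sub_distrib, ← hh]
    ring
  have h1 : |∑ q, M.secondDist w ρ q * ((M.resolvent w).mulVec (M.adv x w) - h) q|
      ≤ M.γ * (κ * B) / (1 - M.γ) := by
    refine M.abs_sum_secondDist_mul_le hρ hw fun q => ?_
    rw [hh, M.resolvent_sub_mulVec hx hw]
    refine M.abs_resolvent_mulVec_le hw (fun p => ?_) q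
    rw [Pi.smul_apply, smul_eq_mul, abs_mul, abs_of_pos hγ]
    exact mul_le_mul_of_nonneg_left (M.abs_trans_sub_mulVec_le x w hB0 hhB p) hγ.le
  have h2 := M.abs_sum_secondDist_sub_le hρ x w hB0 hhB
  rw [key]
  refine (abs_add_le _ _).trans ?_
  rw [abs_mul, abs_mul, abs_of_pos hγ]
  calc _ ≤ M.γ * (M.γ * (κ * B) / (1 - M.γ)) + M.γ * (κ * B) := by gcongr
    -- The two bounds add up through γ/(1-γ) + 1 = 1/(1-γ), the third power of 1/(1-γ).
    _ = M.γ * κ ^ 2 * M.cbarNorm / (2 * (1 - M.γ) ^ 3) := by rw [hB]; field_simp; ring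
    _ = _ := by rw [hκ, mul_pow, Real.sq_sqrt hN0, curvature, ← hN]; ring

theorem differentiableAt_Jhat (M : RiskMDP S A H) {x : PolicySpace S A H}
    (hx : x ∈ policies S A H) (p : S × Fin (H + 1)) :
    DifferentiableAt ℝ (fun z => M.Jhat z p) x := by
  -- The gradient sees parameters that are not policies; the series still converges there, since
  -- norm < 1 is an open condition.
  have hopen : ∀ᶠ z in nhds x, ‖M.γ • M.trans z‖ < 1 :=
    (M.differentiable_trans.continuous.const_smul M.γ).norm.continuousAt.eventually_lt_const
      (M.norm_lt_one hx)
  have heq : (fun z => M.Jhat z p) =ᶠ[nhds x]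
      fun z => (Ring.inverse (1 - M.γ • M.trans z)).mulVec (M.stepCost z) p :=
    hopen.mono fun z hz => by
      simp only [M.Jhat_eq_resolvent hz, M.resolvent_eq_inverse hz]
  refine DifferentiableAt.congr_of_eventuallyEq ?_ heq
  have hu : IsUnit (1 - M.γ • M.trans x) := (Units.oneSub _ (M.norm_lt_one hx)).isUnit
  have hinv : DifferentiableAt ℝ (fun z => Ring.inverse (1 - M.γ • M.trans z)) x :=
    DifferentiableAt.comp (g := Ring.inverse) x (differentiableAt_inverse hu)
      ((M.differentiable_trans.const_smul M.γ).const_sub 1).differentiableAt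
  have hentry : ∀ q, DifferentiableAt ℝ
      (fun z => Ring.inverse (1 - M.γ • M.trans z) p q) x := fun q =>
    ((Matrix.entryLinearMap ℝ ℝ p q).toContinuousLinearMap.differentiableAt).comp x hinv
  simp only [Matrix.mulVec, dotProduct, stepCost, later]
  fun_prop

theorem differentiableAt_J (M : RiskMDP S A H) (ρ : S → ℝ) {x : PolicySpace S A H}
    (hx : x ∈ policies S A H) : DifferentiableAt ℝ (M.J ρ) x := by
  have h := M.differentiableAt_Jhat hx
  unfold J Q first
  fun_prop

end RiskMDP

/-! ### Projected gradient descent under a two-sided quadratic bound -/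

section ProjectedGradient

open scoped RealInnerProductSpace

variable {E : Type*} [NormedAddCommGroup E] [InnerProductSpace ℝ E]

theorem IsEuclideanProj.inner_le_zero {K : Set E} (hK : Convex ℝ K) {x y : E}
    (h : IsEuclideanProj K x y) {z : E} (hz : z ∈ K) : ⟪x - y, z - y⟫ ≤ 0 := by
  refine (norm_eq_iInf_iff_real_inner_le_zero hK h.1).1 ?_ z hz
  have : Nonempty K := ⟨⟨y, h.1⟩⟩
  exact le_antisymm (le_ciInf fun w => h.2 w w.2)
    (ciInf_le ⟨0, by rintro _ ⟨w, rfl⟩; exact norm_nonneg _⟩ (⟨y, h.1⟩ : K))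

variable {K : Set E} {f : E → ℝ} {g : E → E} {L R : ℝ}

theorem IsEuclideanProj.gradient_step_inner_le (hK : Convex ℝ K) (hL : 0 < L) {a b : E}
    (hab : IsEuclideanProj K (a - L⁻¹ • g a) b) {z : E} (hz : z ∈ K) :
    ⟪g a, b - z⟫ ≤ L * ⟪a - b, b - z⟫ := by
  have h := hab.inner_le_zero hK hz
  have e : a - L⁻¹ • g a - b = (a - b) - L⁻¹ • g a := by abel
  rw [e, inner_sub_left, real_inner_smul_left, ← neg_sub b z, inner_neg_right, inner_neg_right] at h
  have h2 : L⁻¹ * ⟪g a, b - z⟫ ≤ ⟪a - b, b - z⟫ := by linarith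
  rwa [inv_mul_le_iff₀ hL] at h2

theorem IsEuclideanProj.descent (hK : Convex ℝ K) (hL : 0 < L)
    (hf : ∀ a ∈ K, ∀ w ∈ K, |f w - f a - ⟪g a, w - a⟫| ≤ L / 4 * ‖w - a‖ ^ 2) {a b : E}
    (ha : a ∈ K) (hab : IsEuclideanProj K (a - L⁻¹ • g a) b) :
    f b ≤ f a - 3 / 4 * L * ‖b - a‖ ^ 2 := by
  have h1 := hab.gradient_step_inner_le hK hL ha
  have h2 := (abs_le.1 (hf a ha b hab.1)).2
  rw [← neg_sub b a, inner_neg_left, real_inner_self_eq_norm_sq] at h1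
  linarith

/-- The projection inequality controls g at a, not at b. No Lipschitz bound on g is assumed: the
expansions at a and b are compared at a point w of K at distance at most δ from b. -/
theorem IsEuclideanProj.stationarity (hK : Convex ℝ K) (hL : 0 < L)
    (hf : ∀ a ∈ K, ∀ w ∈ K, |f w - f a - ⟪g a, w - a⟫| ≤ L / 4 * ‖w - a‖ ^ 2)
    (hR : ∀ a ∈ K, ∀ w ∈ K, ‖w - a‖ ≤ R) {a b : E}
    (ha : a ∈ K) (hab : IsEuclideanProj K (a - L⁻¹ • g a) b) {z : E} (hz : z ∈ K) :
    ⟪g b, b - z⟫ ≤ 5 / 2 * L * ‖b - a‖ * R := by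
  have h1 := hab.gradient_step_inner_le hK hL hz
  rcases (norm_nonneg (b - a)).eq_or_lt with h0 | hδ
  · have : b = a := sub_eq_zero.1 (norm_eq_zero.1 h0.symm)
    subst this
    simpa using h1
  have hδR := hR a ha b hab.1
  have hR0 : 0 < R := hδ.trans_le hδR
  have hzR := hR b hab.1 z hz
  set δ := ‖b - a‖ with hδ'
  -- The largest fraction of the way to z for which the diameter bound guarantees ‖w - b‖ ≤ δ.
  set s := δ / R with hs
  have hs0 : 0 < s := div_pos hδ hR0
  have hsR : s * R = δ := div_mul_cancel₀ _ hR0.ne'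
  have hsz : s * ‖z - b‖ ≤ δ := hsR ▸ mul_le_mul_of_nonneg_left hzR hs0.le
  set w := b + s • (z - b) with hw
  have hwK : w ∈ K := hK.add_smul_sub_mem hab.1 hz ⟨hs0.le, (div_le_one hR0).2 hδR⟩
  have e1 : ‖w - b‖ = s * ‖z - b‖ := by
    rw [hw, add_sub_cancel_left, norm_smul, Real.norm_of_nonneg hs0.le]
  have e2 : ‖w - a‖ ≤ 2 * δ := by
    calc ‖w - a‖ = ‖(w - b) + (b - a)‖ := by rw [sub_add_sub_cancel]
      _ ≤ ‖w - b‖ + ‖b - a‖ := norm_add_le _ _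
      _ ≤ 2 * δ := by rw [e1]; linarith
  have e1' : ‖w - b‖ ^ 2 ≤ δ ^ 2 := by rw [e1]; gcongr
  have e2' : ‖w - a‖ ^ 2 ≤ 4 * δ ^ 2 := by
    calc ‖w - a‖ ^ 2 ≤ (2 * δ) ^ 2 := by gcongr
      _ = _ := by ring
  have q1 := (abs_le.1 (hf b hab.1 w hwK)).2
  have q2 := (abs_le.1 (hf a ha w hwK)).1
  have q3 := (abs_le.1 (hf a ha b hab.1)).2
  have i1 : ⟪g b, w - b⟫ = -(s * ⟪g b, b - z⟫) := by
    rw [hw, add_sub_cancel_left, real_inner_smul_right, ← neg_sub b z, inner_neg_right]; ring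
  have i2 : ⟪g a, w - a⟫ = ⟪g a, b - a⟫ - s * ⟪g a, b - z⟫ := by
    rw [hw, add_sub_right_comm, inner_add_right, real_inner_smul_right, ← neg_sub b z,
      inner_neg_right]; ring
  rw [← hδ'] at q3
  rw [i1] at q1
  rw [i2] at q2
  have h2 : ⟪g a, b - z⟫ ≤ L * (δ * R) := by
    refine h1.trans (mul_le_mul_of_nonneg_left ?_ hL.le)
    refine (real_inner_le_norm _ _).trans ?_
    rw [norm_sub_rev a b, norm_sub_rev b z]
    exact mul_le_mul_of_nonneg_left hzR hδ.le
  have b1 := mul_le_mul_of_nonneg_left e1' (by positivity : 0 ≤ L / 4)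
  have b2 := mul_le_mul_of_nonneg_left e2' (by positivity : 0 ≤ L / 4)
  have b3 := mul_le_mul_of_nonneg_left h2 hs0.le
  have e3 : s * (L * (δ * R)) = L * δ ^ 2 := by
    calc s * (L * (δ * R)) = L * δ * (s * R) := by ring
      _ = _ := by rw [hsR]; ring
  refine le_of_mul_le_mul_left ?_ hs0
  -- 5/2 = 1/4 + 1 + 1/4 + 1: the three expansion errors, with ‖w - a‖ ≤ 2δ in the second, and the
  -- projection inequality at a.
  calc s * ⟪g b, b - z⟫ ≤ 5 / 2 * (L * δ ^ 2) := by linarith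
    _ = s * (5 / 2 * L * δ * R) := by rw [← e3]; ring

/-- Some iterate of projected gradient descent is nearly stationary. -/
theorem exists_nearly_stationary_iterate (hK : Convex ℝ K) (hL : 0 < L) {B : ℝ}
    (hf : ∀ a ∈ K, ∀ w ∈ K, |f w - f a - ⟪g a, w - a⟫| ≤ L / 4 * ‖w - a‖ ^ 2)
    (hR : ∀ a ∈ K, ∀ w ∈ K, ‖w - a‖ ≤ R) (h0 : ∀ a ∈ K, 0 ≤ f a) (hB : ∀ a ∈ K, f a ≤ B)
    {x : ℕ → E} (hx0 : x 0 ∈ K)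
    (hx : ∀ t, IsEuclideanProj K (x t - L⁻¹ • g (x t)) (x (t + 1))) {T : ℕ} (hT : 0 < T) :
    ∃ t < T, ∃ δ, 0 ≤ δ ∧ T * (3 / 4 * L * δ ^ 2) ≤ B ∧
      ∀ z ∈ K, ⟪g (x (t + 1)), x (t + 1) - z⟫ ≤ 5 / 2 * L * δ * R := by
  have hxK : ∀ t, x t ∈ K := fun t => by
    cases t with
    | zero => exact hx0
    | succ t => exact (hx t).1
  have hsum : ∀ n : ℕ, ∑ t ∈ Finset.range n, 3 / 4 * L * ‖x (t + 1) - x t‖ ^ 2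
      ≤ f (x 0) - f (x n) := fun n => by
    induction n with
    | zero => simp
    | succ n ih =>
      rw [Finset.sum_range_succ]
      have := (hx n).descent hK hL hf (hxK n)
      linarith
  obtain ⟨t, ht, hle⟩ : ∃ t ∈ Finset.range T,
      3 / 4 * L * ‖x (t + 1) - x t‖ ^ 2 ≤ B / T := by
    refine Finset.exists_le_of_sum_le (Finset.nonempty_range_iff.2 hT.ne') ?_
    rw [Finset.sum_const, Finset.card_range, nsmul_eq_mul, mul_div_cancel₀ _ (by positivity)]
    linarith [hsum T, h0 _ (hxK T), hB _ (hxK 0)]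
  refine ⟨t, Finset.mem_range.1 ht, ‖x (t + 1) - x t‖, norm_nonneg _, ?_, fun z hz =>
    (hx t).stationarity hK hL hf hR (hxK t) hz⟩
  rwa [le_div_iff₀' (by positivity)] at hle

end ProjectedGradient

/-! ### The gradient of the objective along feasible directions -/

namespace RiskMDP

variable {S A : Type*} [Fintype S] [Fintype A] [DecidableEq S] {H : ℕ}

theorem dirDeriv_add_smul_sub (M : RiskMDP S A H) (ρ : S → ℝ) (x w : PolicySpace S A H) (s : ℝ) :
    M.dirDeriv ρ x (x + s • (w - x)) = s * M.dirDeriv ρ x w := by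
  have h1 : M.advFirst x (x + s • (w - x)) = s • M.advFirst x w := by
    ext p
    simp [advFirst, first, Finset.mul_sum, mul_assoc]
  have h2 : M.adv x (x + s • (w - x)) = s • M.adv x w := by
    ext p
    simp [adv, later, Finset.mul_sum, mul_assoc]
  simp only [dirDeriv, h1, h2, Matrix.mulVec_smul, Pi.smul_apply, smul_eq_mul, mul_left_comm _ s,
    ← Finset.mul_sum]
  ring

/-- The quadratic expansion holds only between policies, so it gives a one-sided derivative along
the segment to w. This determines the full derivative, which exists. -/
theorem fderiv_J_sub (M : RiskMDP S A H) {ρ : S → ℝ} (hρ : ρ ∈ stdSimplex ℝ S)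
    {x w : PolicySpace S A H} (hx : x ∈ policies S A H) (hw : w ∈ policies S A H) :
    fderiv ℝ (M.J ρ) x (w - x) = M.dirDeriv ρ x w := by
  have h1 : HasDerivAt (fun s : ℝ => M.J ρ (x + s • (w - x))) (fderiv ℝ (M.J ρ) x (w - x)) 0 :=
    (M.differentiableAt_J ρ hx).hasFDerivAt.hasLineDerivAt (w - x)
  have h2 : HasDerivAt (fun s : ℝ => M.J ρ (x + s • (w - x)) - M.J ρ x - s * M.dirDeriv ρ x w)
      (fderiv ℝ (M.J ρ) x (w - x) - 1 * M.dirDeriv ρ x w) 0 :=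
    (h1.sub_const _).sub ((hasDerivAt_id 0).mul_const _)
  have h3 : (fun s : ℝ => M.J ρ (x + s • (w - x)) - M.J ρ x - s * M.dirDeriv ρ x w)
      =O[nhdsWithin 0 (Set.Icc 0 1)] fun s => ‖s - 0‖ ^ 2 := by
    refine Asymptotics.IsBigO.of_bound (M.curvature * ‖w - x‖ ^ 2) ?_
    filter_upwards [self_mem_nhdsWithin] with s hs
    have := M.abs_J_sub_dirDeriv_le hρ hx (convex_policies.add_smul_sub_mem hx hw hs)
    rw [dirDeriv_add_smul_sub, add_sub_cancel_left, norm_smul, mul_pow] at this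
    simpa [mul_assoc, mul_comm, mul_left_comm] using this
  have h4 := (h3.hasFDerivWithinAt (by simp) one_lt_two).hasDerivWithinAt
  have h5 := (uniqueDiffOn_Icc zero_lt_one (0 : ℝ) (by simp)).eq_deriv _ h2.hasDerivWithinAt h4
  simp only [one_mul, zero_apply] at h5
  linarith

theorem inner_gradient_J (M : RiskMDP S A H) {ρ : S → ℝ} (hρ : ρ ∈ stdSimplex ℝ S)
    {x w : PolicySpace S A H} (hx : x ∈ policies S A H) (hw : w ∈ policies S A H) :
    inner ℝ (gradient (M.J ρ) x) (w - x) = M.dirDeriv ρ x w := by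
  rw [gradient, InnerProductSpace.toDual_symm_apply, M.fderiv_J_sub hρ hx hw]

end RiskMDP

/-! ### Gradient domination and the change of measure -/

theorem le_toReal_mul_of_supRatio_le {X : Type*} {f g : X → ℝ} (hg : ∀ i, 0 ≤ g i) {c : ℝ≥0∞}
    (hc : c ≠ ∞) (h : supRatio f g ≤ c) (i : X) : f i ≤ c.toReal * g i := by
  have h1 : ENNReal.ofReal (f i) / ENNReal.ofReal (g i) ≤ c :=
    (le_iSup (fun i => ENNReal.ofReal (f i) / ENNReal.ofReal (g i)) i).trans h
  rw [ENNReal.div_le_iff_le_mul (Or.inr hc) (Or.inl ENNReal.ofReal_ne_top)] at h1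
  rw [← ENNReal.ofReal_toReal hc, ← ENNReal.ofReal_mul ENNReal.toReal_nonneg] at h1
  exact (ENNReal.ofReal_le_ofReal_iff (mul_nonneg ENNReal.toReal_nonneg (hg i))).1 h1

/-- The greedy improvement of a policy with respect to first-step and later action values. -/
theorem exists_greedy_policy {S A : Type*} [Fintype A] [Nonempty A] {H : ℕ}
    (Q₁ : S → A × Fin (H + 1) → ℝ) (Q₂ : S × Fin (H + 1) → A × Fin (H + 1) → ℝ) :
    ∃ z ∈ policies S A H, ∀ y ∈ policies S A H,
      (∀ s, ∑ b, first z s b * Q₁ s b ≤ ∑ b, first y s b * Q₁ s b) ∧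
      ∀ p, ∑ b, later z p b * Q₂ p b ≤ ∑ b, later y p b * Q₂ p b := by
  classical
  choose b₁ hb₁ using fun s => Finite.exists_min (Q₁ s)
  choose b₂ hb₂ using fun p => Finite.exists_min (Q₂ p)
  let z : PolicySpace S A H := WithLp.toLp 2 (Sum.elim
    (fun i => (Pi.single (b₁ i.1) 1 : A × Fin (H + 1) → ℝ) i.2)
    (fun i => (Pi.single (b₂ (i.1, i.2.1)) 1 : A × Fin (H + 1) → ℝ) i.2.2))
  have e₁ : ∀ s, first z s = Pi.single (b₁ s) 1 := fun s => rfl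
  have e₂ : ∀ p, later z p = Pi.single (b₂ p) 1 := fun p => rfl
  have key : ∀ (f : A × Fin (H + 1) → ℝ) (b : A × Fin (H + 1)), (∀ b', f b ≤ f b') →
      ∀ p ∈ stdSimplex ℝ (A × Fin (H + 1)),
        ∑ i, (Pi.single b 1 : A × Fin (H + 1) → ℝ) i * f i ≤ ∑ i, p i * f i := by
    intro f b hb p hp
    have h1 : ∑ i, (Pi.single b 1 : A × Fin (H + 1) → ℝ) i * f i = f b := by
      simp [Pi.single_apply]
    rw [h1]
    calc f b = ∑ i, p i * f b := by rw [← Finset.sum_mul, hp.2, one_mul]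
      _ ≤ _ := Finset.sum_le_sum fun i _ => mul_le_mul_of_nonneg_left (hb i) (hp.1 i)
  refine ⟨z, ⟨fun s => ?_, fun p => ?_⟩, fun y hy => ⟨fun s => ?_, fun p => ?_⟩⟩
  · rw [e₁]; exact single_mem_stdSimplex ℝ _
  · rw [e₂]; exact single_mem_stdSimplex ℝ _
  · rw [e₁]; exact key _ _ (hb₁ s) _ (hy.1 s)
  · rw [e₂]; exact key _ _ (hb₂ p) _ (hy.2 p)

namespace RiskMDP

variable {S A : Type*} [Fintype S] [Fintype A] {H : ℕ}

theorem nextMass_nonneg (M : RiskMDP S A H) {μ : S → ℝ} (hμ : μ ∈ stdSimplex ℝ S)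
    (q : S × Fin (H + 1)) : 0 ≤ M.nextMass μ q :=
  Finset.sum_nonneg fun s _ => Finset.sum_nonneg fun _ _ => mul_nonneg (hμ.1 s) ((M.P_mem _ _).1 _)

theorem secondDist_nonneg (M : RiskMDP S A H) {μ : S → ℝ} (hμ : μ ∈ stdSimplex ℝ S)
    {x : PolicySpace S A H} (hx : x ∈ policies S A H) (q : S × Fin (H + 1)) :
    0 ≤ M.secondDist x μ q :=
  Finset.sum_nonneg fun s _ => mul_nonneg (hμ.1 s) (Finset.sum_nonneg fun _ _ =>
    mul_nonneg ((hx.1 s).1 _) ((M.P_mem _ _).1 _))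

theorem mul_nextMass_le_secondDist (M : RiskMDP S A H) {μ : S → ℝ} (hμ : μ ∈ stdSimplex ℝ S)
    {x : PolicySpace S A H} {lb : ℝ} (hlb : ∀ s b, lb ≤ first x s b) (q : S × Fin (H + 1)) :
    lb * M.nextMass μ q ≤ M.secondDist x μ q := by
  simp only [nextMass, secondDist, Finset.mul_sum]
  refine Finset.sum_le_sum fun s _ => Finset.sum_le_sum fun a _ => ?_
  rw [mul_left_comm]
  exact mul_le_mul_of_nonneg_left
    (mul_le_mul_of_nonneg_right (hlb s _) ((M.P_mem _ _).1 _)) (hμ.1 s)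

variable [DecidableEq S]

theorem mul_le_visit (M : RiskMDP S A H) {x : PolicySpace S A H} (hx : x ∈ policies S A H)
    {ν : S × Fin (H + 1) → ℝ} (hν : ∀ q, 0 ≤ ν q) (q : S × Fin (H + 1)) :
    (1 - M.γ) * ν q ≤ M.visit x ν q := by
  rw [M.visit_eq_resolvent (M.norm_lt_one hx)]
  refine mul_le_mul_of_nonneg_left ?_ (sub_pos.2 M.γ_lt_one).le
  calc ν q ≤ ν q * M.resolvent x q q := le_mul_of_one_le_right (hν q) (M.one_le_resolvent_diag hx q)
    _ ≤ _ := Finset.single_le_sum (f := fun p => ν p * M.resolvent x p q)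
        (fun p _ => mul_nonneg (hν p) (M.resolvent_nonneg hx p q)) (Finset.mem_univ q)

theorem visit_nonneg (M : RiskMDP S A H) {x : PolicySpace S A H} (hx : x ∈ policies S A H)
    {ν : S × Fin (H + 1) → ℝ} (hν : ∀ q, 0 ≤ ν q) (q : S × Fin (H + 1)) :
    0 ≤ M.visit x ν q :=
  (mul_nonneg (sub_pos.2 M.γ_lt_one).le (hν q)).trans (M.mul_le_visit hx hν q)

theorem sum_mul_resolvent_mulVec (M : RiskMDP S A H) {x : PolicySpace S A H}
    (hx : x ∈ policies S A H) (ν v : S × Fin (H + 1) → ℝ) :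
    ∑ q, ν q * (M.resolvent x).mulVec v q = 1 / (1 - M.γ) * ∑ q, M.visit x ν q * v q := by
  have h0 : 1 - M.γ ≠ 0 := (sub_pos.2 M.γ_lt_one).ne'
  simp only [M.visit_eq_resolvent (M.norm_lt_one hx), mul_assoc, ← Finset.mul_sum]
  rw [← mul_assoc, one_div_mul_cancel h0, one_mul]
  simp only [Matrix.mulVec, dotProduct, Finset.mul_sum, Finset.sum_mul, ← mul_assoc]
  exact Finset.sum_comm

/-- The gradient domination inequality. -/
theorem exists_J_sub_le_mul_dirDeriv (M : RiskMDP S A H) {ρ μ : S → ℝ}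
    (hρ : ρ ∈ stdSimplex ℝ S) {x y : PolicySpace S A H} (hx : x ∈ policies S A H)
    (hy : y ∈ policies S A H) {D : ℝ} (h₁ : ∀ s, ρ s ≤ D * μ s)
    (h₂ : ∀ q, M.visit y (M.secondDist y ρ) q ≤ D * M.visit x (M.secondDist x μ) q) :
    ∃ z ∈ policies S A H, M.J ρ x - M.J ρ y ≤ D * -M.dirDeriv μ x z := by
  have hγ : 0 < M.γ / (1 - M.γ) := div_pos M.γ_pos (sub_pos.2 M.γ_lt_one)
  have hs : ∃ s, 0 < ρ s := by
    by_contra! h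
    have := Finset.sum_nonpos fun s (_ : s ∈ Finset.univ) => h s
    rw [hρ.2] at this
    linarith
  obtain ⟨s₀, -⟩ := hs
  have hA : Nonempty A := by
    by_contra h
    rw [not_nonempty_iff] at h
    simpa using (hx.1 s₀).2
  -- A single z minimizes both kinds of action value at every state, so it beats y pointwise and has
  -- nonpositive advantages.
  obtain ⟨z, hz, hzmin⟩ := exists_greedy_policy (M.Q x) (M.Qhat x)
  have f1 : ∀ y ∈ policies S A H, ∀ s, M.advFirst x z s ≤ M.advFirst x y s := fun y hy s => by
    simp only [advFirst, sub_mul, Finset.sum_sub_distrib]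
    linarith [(hzmin y hy).1 s]
  have f2 : ∀ y ∈ policies S A H, ∀ q, M.adv x z q ≤ M.adv x y q := fun y hy q => by
    simp only [adv, sub_mul, Finset.sum_sub_distrib]
    linarith [(hzmin y hy).2 q]
  have g1 : ∀ s, M.advFirst x z s ≤ 0 := fun s => (f1 x hx s).trans_eq (by simp [advFirst])
  have g2 : ∀ q, M.adv x z q ≤ 0 := fun q => (f2 x hx q).trans_eq (by simp [adv])
  have e1 : M.J ρ x - M.J ρ y = ∑ s, ρ s * -M.advFirst x y s
      + M.γ / (1 - M.γ) * ∑ q, M.visit y (M.secondDist y ρ) q * -M.adv x y q := by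
    rw [← neg_sub, J_sub, M.Jhat_sub hx hy, M.sum_mul_resolvent_mulVec hy]
    simp only [mul_neg, Finset.sum_neg_distrib]
    ring
  have e2 : D * -M.dirDeriv μ x z = ∑ s, D * μ s * -M.advFirst x z s
      + M.γ / (1 - M.γ) * ∑ q, D * M.visit x (M.secondDist x μ) q * -M.adv x z q := by
    rw [dirDeriv, M.sum_mul_resolvent_mulVec hx]
    simp only [mul_neg, Finset.sum_neg_distrib, mul_assoc, ← Finset.mul_sum]
    ring
  refine ⟨z, hz, ?_⟩
  rw [e1, e2]
  refine add_le_add (Finset.sum_le_sum fun s _ => ?_)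
    (mul_le_mul_of_nonneg_left (Finset.sum_le_sum fun q _ => ?_) hγ.le)
  · exact (mul_le_mul_of_nonneg_left (neg_le_neg (f1 y hy s)) (hρ.1 s)).trans
      (mul_le_mul_of_nonneg_right (h₁ s) (neg_nonneg.2 (g1 s)))
  · exact (mul_le_mul_of_nonneg_left (neg_le_neg (f2 y hy q))
      (M.visit_nonneg hy (M.secondDist_nonneg hρ hy) q)).trans
      (mul_le_mul_of_nonneg_right (h₂ q) (neg_nonneg.2 (g2 q)))

theorem IsOptimal.J_eq_Jstar {M : RiskMDP S A H} {ρ : S → ℝ} {y : PolicySpace S A H}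
    (hy : M.IsOptimal ρ y) : M.J ρ y = M.Jstar ρ := by
  have h : IsLeast (M.J ρ '' policies S A H) (M.J ρ y) :=
    ⟨⟨y, hy.1, rfl⟩, by rintro _ ⟨z, hz, rfl⟩; exact hy.2 hz⟩
  exact h.csInf_eq.symm

theorem IsProjectedGD.mem {M : RiskMDP S A H} {μ : S → ℝ} {x : ℕ → PolicySpace S A H}
    (hx : M.IsProjectedGD μ x) (t : ℕ) : x t ∈ policies S A H := by
  cases t with
  | zero => exact hx.1
  | succ t => exact (hx.2 t).1

theorem firstLB_le {M : RiskMDP S A H} {μ : S → ℝ} {x : ℕ → PolicySpace S A H}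
    (hx : M.IsProjectedGD μ x) (t : ℕ) (s : S) (b : A × Fin (H + 1)) :
    firstLB x ≤ first (x (t + 1)) s b :=
  ciInf_le (f := fun i : ℕ × S × A × Fin (H + 1) => first (x (i.1 + 1)) i.2.1 i.2.2)
    ⟨0, by rintro _ ⟨i, rfl⟩; exact ((hx.mem (i.1 + 1)).1 _).1 _⟩ (t, s, b)

theorem firstLB_nonneg {M : RiskMDP S A H} {μ : S → ℝ} {x : ℕ → PolicySpace S A H}
    (hx : M.IsProjectedGD μ x) : 0 ≤ firstLB x :=
  Real.iInf_nonneg fun i => ((hx.mem (i.1 + 1)).1 _).1 _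

theorem visit_le_D₁_mul_visit {M : RiskMDP S A H} {μ ρ : S → ℝ} (hμ : μ ∈ stdSimplex ℝ S)
    {x : ℕ → PolicySpace S A H} (hx : M.IsProjectedGD μ x) {y : PolicySpace S A H}
    (hD : M.D₁ ρ μ (firstLB x) y ≠ ∞) (t : ℕ) (q : S × Fin (H + 1)) :
    M.visit y (M.secondDist y ρ) q ≤
      (M.D₁ ρ μ (firstLB x) y).toReal * M.visit (x (t + 1)) (M.secondDist (x (t + 1)) μ) q := by
  have h0 : 0 < 1 - M.γ := sub_pos.2 M.γ_lt_one
  set D := M.D₁ ρ μ (firstLB x) y with hDdef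
  have hlb := firstLB_nonneg hx
  -- This also covers `firstLB x = 0`, where D ≠ ∞ forces the ratio to vanish.
  have h1 : supRatio (M.visit y (M.secondDist y ρ)) (M.nextMass μ) ≤
      D * ENNReal.ofReal ((1 - M.γ) * firstLB x) := by
    have h2 : (ENNReal.ofReal ((1 - M.γ) * firstLB x))⁻¹ *
        supRatio (M.visit y (M.secondDist y ρ)) (M.nextMass μ) ≤ D := le_max_right _ _
    rwa [mul_comm, ← div_eq_mul_inv,
      ENNReal.div_le_iff_le_mul (Or.inr hD) (Or.inl ENNReal.ofReal_ne_top)] at h2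
  have h3 := le_toReal_mul_of_supRatio_le (M.nextMass_nonneg hμ)
    (ENNReal.mul_ne_top hD ENNReal.ofReal_ne_top) h1 q
  rw [ENNReal.toReal_mul, ENNReal.toReal_ofReal (mul_nonneg h0.le hlb)] at h3
  have h4 := mul_le_mul_of_nonneg_left (M.mul_nextMass_le_secondDist hμ (firstLB_le hx t) q) h0.le
  have h5 := M.mul_le_visit (hx.mem (t + 1)) (M.secondDist_nonneg hμ (hx.mem (t + 1))) q
  have h6 := mul_le_mul_of_nonneg_left (h4.trans h5) (ENNReal.toReal_nonneg (a := D))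
  linarith

end RiskMDP

/-! ### Assembling the constants -/

theorem theorem3 {S A : Type*} [Fintype S] [Fintype A] [DecidableEq S] {H : ℕ}
    (M : RiskMDP S A H)
    (μ : S → ℝ) (hμ : μ ∈ stdSimplex ℝ S)
    (x : ℕ → PolicySpace S A H) (hx : M.IsProjectedGD μ x)
    (ρ : S → ℝ) (hρ : ρ ∈ stdSimplex ℝ S)
    (y : PolicySpace S A H) (hy : M.IsOptimal ρ y)
    (ε : ℝ) (hε : 0 < ε) (T : ℕ)
    (hT : M.D₁ ρ μ (firstLB x) y ^ 2 *
        ENNReal.ofReal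
          (128 * M.γ * Fintype.card S * Fintype.card A * ((H + 1 : ℕ) : ℝ) ^ 2 /
            ((1 - M.γ) ^ 3 * ε ^ 2) * M.Cbar * M.cbarNorm) ≤ (T : ℝ≥0∞)) :
    ∃ t ∈ Finset.Icc 1 T, M.J ρ (x t) - M.Jstar ρ ≤ ε := by
  have h0 : 0 < 1 - M.γ := sub_pos.2 M.γ_lt_one
  have hγ := M.γ_pos
  have hcn : 0 < M.cbarNorm := one_pos.trans_le M.one_le_cbarNorm
  have hCbar : 0 < M.Cbar := by
    have h1 := M.lam_nonneg
    have h2 := M.α_pos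
    unfold RiskMDP.Cbar
    positivity
  obtain ⟨s₀⟩ : Nonempty S := by
    by_contra h
    rw [not_nonempty_iff] at h
    simpa using hρ.2
  have hS : 0 < (Fintype.card S : ℝ) := by
    exact_mod_cast Fintype.card_pos_iff.2 ⟨s₀⟩
  have hA : 0 < (Fintype.card A : ℝ) := by
    have : Nonempty A := by
      by_contra h
      rw [not_nonempty_iff] at h
      simpa using (hy.1.1 s₀).2
    exact_mod_cast Fintype.card_pos
  set h : ℝ := ((H + 1 : ℕ) : ℝ) with hh
  have hh0 : 0 < h := by positivity
  set c : ℝ := 128 * M.γ * Fintype.card S * Fintype.card A * h ^ 2 /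
    ((1 - M.γ) ^ 3 * ε ^ 2) * M.Cbar * M.cbarNorm with hc
  have hc0 : 0 < c := by positivity
  have hDtop : M.D₁ ρ μ (firstLB x) y ≠ ∞ := by
    intro htop
    rw [htop, ENNReal.top_pow two_ne_zero,
      ENNReal.top_mul (ENNReal.ofReal_pos.2 hc0).ne'] at hT
    exact (ENNReal.natCast_ne_top T) (top_le_iff.1 hT)
  set D : ℝ := (M.D₁ ρ μ (firstLB x) y).toReal with hD
  have hρμ : ∀ s, ρ s ≤ D * μ s := le_toReal_mul_of_supRatio_le hμ.1 hDtop (le_max_left _ _)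
  -- Both distributions have mass 1; this yields T > 0.
  have hD1 : 1 ≤ D := by
    have := Finset.sum_le_sum fun s (_ : s ∈ Finset.univ) => hρμ s
    rwa [← Finset.mul_sum, hρ.2, hμ.2, mul_one] at this
  have hTr : D ^ 2 * c ≤ T := by
    have := ENNReal.toReal_mono (ENNReal.natCast_ne_top T) hT
    rwa [ENNReal.toReal_mul, ENNReal.toReal_pow, ENNReal.toReal_ofReal hc0.le,
      ENNReal.toReal_natCast] at this
  have hTpos : (0 : ℝ) < T := lt_of_lt_of_le (by positivity) hTr
  set L : ℝ := (M.stepsize)⁻¹ with hL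
  have hLval : L = 2 * M.γ * Fintype.card A * h * M.cbarNorm / (1 - M.γ) ^ 3 := by
    rw [hL, RiskMDP.stepsize, inv_div]
  have hL0 : 0 < L := by rw [hLval]; positivity
  have hquad : ∀ a ∈ policies S A H, ∀ w ∈ policies S A H,
      |M.J μ w - M.J μ a - inner ℝ (gradient (M.J μ) a) (w - a)| ≤ L / 4 * ‖w - a‖ ^ 2 := by
    intro a ha w hw
    rw [M.inner_gradient_J hμ ha hw]
    have e : L / 4 = M.curvature := by rw [hLval, RiskMDP.curvature]; field_simp; ring
    rw [e]
    exact M.abs_J_sub_dirDeriv_le hμ ha hw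
  have hdiam : ∀ a ∈ policies S A H, ∀ w ∈ policies S A H,
      ‖w - a‖ ≤ √(4 * Fintype.card S * h) := fun a ha w hw =>
    Real.le_sqrt_of_sq_le (norm_sub_sq_le_of_mem_policies M.H_pos hw ha)
  have hstep : ∀ t, IsEuclideanProj (policies S A H)
      (x t - L⁻¹ • gradient (M.J μ) (x t)) (x (t + 1)) := fun t => by
    rw [hL, inv_inv]; exact hx.2 t
  obtain ⟨t, htT, δ, hδ0, hδ, hstat⟩ := exists_nearly_stationary_iterate convex_policies hL0 hquad
    hdiam (fun a ha => M.J_nonneg hμ ha) (fun a ha => M.J_le_Cbar hμ ha) hx.1 hstep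
    (Nat.cast_pos.1 hTpos)
  obtain ⟨z, hz, hdom⟩ := M.exists_J_sub_le_mul_dirDeriv hρ (hx.mem (t + 1)) hy.1 hρμ
    (RiskMDP.visit_le_D₁_mul_visit hμ hx hDtop t)
  -- Stationarity holds at the end of the short step, so indices run from 1 to T.
  refine ⟨t + 1, Finset.mem_Icc.2 ⟨by omega, htT⟩, ?_⟩
  rw [← hy.J_eq_Jstar]
  refine hdom.trans ?_
  have hs := hstat z hz
  rw [← neg_sub z, inner_neg_right, M.inner_gradient_J hμ (hx.mem (t + 1)) hz] at hs
  refine (mul_le_mul_of_nonneg_left hs (by positivity)).trans ?_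
  refine abs_le_of_sq_le_sq' ?_ hε.le |>.2
  have hRsq : √(4 * Fintype.card S * h) ^ 2 = 4 * Fintype.card S * h := Real.sq_sqrt (by positivity)
  have hcL : c * ε ^ 2 = 64 * L * Fintype.card S * h * M.Cbar := by
    rw [hc, hLval]; field_simp; ring
  have h1 : D ^ 2 * c * (3 / 4 * L * δ ^ 2) ≤ M.Cbar :=
    (mul_le_mul_of_nonneg_right hTr (by positivity)).trans hδ
  have h2 : D ^ 2 * (64 * L * Fintype.card S * h * M.Cbar) * (3 / 4 * L * δ ^ 2)
      ≤ M.Cbar * ε ^ 2 := by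
    rw [← hcL]
    calc _ = D ^ 2 * c * (3 / 4 * L * δ ^ 2) * ε ^ 2 := by ring
      _ ≤ _ := mul_le_mul_of_nonneg_right h1 (by positivity)
  -- 48 = 64 · 3/4, from the bound on T and the descent rate. The squared gap only needs 25 = (5/2)²
  -- · 4.
  have h3 : 48 * (D ^ 2 * L ^ 2 * Fintype.card S * h * δ ^ 2) ≤ ε ^ 2 := by
    refine le_of_mul_le_mul_left ?_ hCbar
    calc _ = D ^ 2 * (64 * L * Fintype.card S * h * M.Cbar) * (3 / 4 * L * δ ^ 2) := by ring
      _ ≤ _ := h2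
  calc (D * (5 / 2 * L * δ * √(4 * Fintype.card S * h))) ^ 2
      = 25 / 4 * D ^ 2 * L ^ 2 * δ ^ 2 * √(4 * Fintype.card S * h) ^ 2 := by ring
    _ = 25 * (D ^ 2 * L ^ 2 * Fintype.card S * h * δ ^ 2) := by rw [hRsq]; ring
    _ ≤ 48 * (D ^ 2 * L ^ 2 * Fintype.card S * h * δ ^ 2) :=
        mul_le_mul_of_nonneg_right (by norm_num) (by positivity)
    _ ≤ ε ^ 2 := h3
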